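/- Let $X$ be a Polish space (a separable completely metrizable topological space), and let $d$ be any metric on $X$ compatible with its topology (not necessarily complete). A continuum in $X$ is a nonempty compact connected subset of $X$ (one-point sets are continua). For $\varepsilon>0$ let $\mathcal C_\varepsilon(X)$ be the set of continua in $X$ of $d$-diameter $<\varepsilon$, as a subspace of the hyperspace of nonempty compact subsets of $X$ with the Vietoris topology, and let $E_X^{CC,\varepsilon}$ be the relation on $X$ such that $(x,y)\in E_X^{CC,\varepsilon}$ if and only if there are $k\in\mathbb N$ and $K_0,\dots,K_k\in\mathcal C_\varepsilon(X)$ with $x\in K_0$, $y\in K_k$ and $K_i\cap K_{i+1}\neq\emptyset$ for $0\le i<k$. Let $E_X^{CC}=\bigcap_{\varepsilon>0}E_X^{CC,\varepsilon}$. For a metrizable space $Y$ let $E_Y^A$ be the relation on $Y$ such that $(x,y)\in E_Y^A$ if and only if $x=y$ or some arc in $Y$ (a subset homeomorphic to $[0,1]$) contains both $x$ and $y$. For relations $E$ on $S$ and $F$ on $T$, where $S,T$ carry their Borel $\sigma$-algebras, $E$ is Borel reducible to $F$ if there is a Borel map $f:S\to T$ with $(x,y)\in E\iff (f(x),f(y))\in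 F$ for all $x,y\in S$; $E$ and $F$ are Borel bireducible, written $E\sim_B F$, if each is Borel reducible to the other. Then, for every $\varepsilon>0$, $$E_X^{CC,\varepsilon}\sim_B E^A_{\mathcal C_\varepsilon(X)}.$$ Moreover, $$E_X^{CC}\sim_B\bigcap_{n\ge1}E^A_{\mathcal C_{1/n}(X)},$$ where the intersection is regarded as a relation on the space $\bigcap_{n\ge1}\mathcal C_{1/n}(X)$. -/

import Mathlib

open TopologicalSpace

/-- `E` is Borel reducible to `F`. -/
def BorelReducible {X Y : Type*} [MeasurableSpace X] [MeasurableSpace Y]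
    (E : X → X → Prop) (F : Y → Y → Prop) : Prop :=
  ∃ f : X → Y, Measurable f ∧ ∀ x y, E x y ↔ F (f x) (f y)

/-- `E` and `F` are Borel bireducible. -/
def BorelBireducible {X Y : Type*} [MeasurableSpace X] [MeasurableSpace Y]
    (E : X → X → Prop) (F : Y → Y → Prop) : Prop :=
  BorelReducible E F ∧ BorelReducible F E

/-- An arc in `Y`: a subset homeomorphic to `[0,1]`. -/
def IsArc {Y : Type*} [TopologicalSpace Y] (A : Set Y) : Prop :=
  Nonempty (A ≃ₜ unitInterval)

/-- The arc-connection relation on `Y`. One-point sets count as degenerate arcs, so that the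
relation is reflexive. -/
def ArcConn (Y : Type*) [TopologicalSpace Y] (x y : Y) : Prop :=
  x = y ∨ ∃ A : Set Y, IsArc A ∧ x ∈ A ∧ y ∈ A

/-- The hyperspace of nonempty compact sets, whose topology in Mathlib is the Vietoris topology,
carries the Borel `σ`-algebra; its subspaces carry the induced one, which is again Borel. -/
instance instMeasurableSpaceNonemptyCompacts (X : Type*) [TopologicalSpace X] :
    MeasurableSpace (NonemptyCompacts X) := borel _

instance instBorelSpaceNonemptyCompacts (X : Type*) [TopologicalSpace X] :
    BorelSpace (NonemptyCompacts X) := ⟨rfl⟩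

/-- The hyperspace of continua of diameter less than `ε`. -/
def smallContinua (X : Type*) [MetricSpace X] (ε : ℝ) : Set (NonemptyCompacts X) :=
  {K | IsConnected (K : Set X) ∧ Metric.diam (K : Set X) < ε}

/-- The `ε`-chain continuum-connection relation: `x` and `y` are joined by a finite chain
`K 0, …, K k` of continua of diameter less than `ε`, consecutive ones intersecting. -/
def EpsChainConn (X : Type*) [MetricSpace X] (ε : ℝ) (x y : X) : Prop :=
  ∃ (k : ℕ) (K : Fin (k + 1) → NonemptyCompacts X),
    (∀ i, K i ∈ smallContinua X ε) ∧ x ∈ K 0 ∧ y ∈ K (Fin.last k) ∧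
      ∀ i : Fin k, ((K i.castSucc : Set X) ∩ (K i.succ : Set X)).Nonempty

/-- The chain continuum-connection relation. -/
def ChainConn (X : Type*) [MetricSpace X] (x y : X) : Prop :=
  ∀ ε : ℝ, 0 < ε → EpsChainConn X ε x y

/-- The intersection over `n ≥ 1` (written `n + 1`, `n : ℕ`) of the arc-connection relations of
the spaces of continua of diameter less than `1 / n`. As a set of pairs it lies in the square of
the intersection of these spaces, and it is a relation on that intersection. -/
def InterArcConn (X : Type*) [MetricSpace X]
    (K L : ↥(⋂ n : ℕ, smallContinua X (1 / ((n : ℝ) + 1)))) : Prop :=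
  ∀ n : ℕ, ArcConn (smallContinua X (1 / ((n : ℝ) + 1)))
    ⟨K.1, Set.mem_iInter.1 K.2 n⟩ ⟨L.1, Set.mem_iInter.1 L.2 n⟩

/-! Everything rests on `arcConn_iff_epsChainConn`: for small continua `K ∋ x` and `L ∋ y`, an arc
from `K` to `L` among the small continua exists exactly when `x` and `y` are `ε`-chain connected.
Hence `x ↦ {x}` and any Borel selector `K ↦ g K ∈ K` are reductions in the two directions; the same
maps work at all `ε = 1 / n` at once.

From chains to arcs: a maximal chain of continua between `{x}` and `K` is an arc
(`arcConn_singleton`), and arcs concatenate. From arcs to chains: the union of the continua along a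
short piece of an arc is a continuum, still of diameter `< ε` because that bound is strict
(`eventually_smallContinuumAdj`). -/

open Set Filter Topology unitInterval

/-! ### Boundary bumping. -/

/-- A proper subcontinuum of a continuum is not maximal among its proper subcontinua. -/
theorem IsConnected.exists_isCompact_between {X : Type*} [TopologicalSpace X] [T2Space X]
    {A B : Set X} (hA : IsConnected A) (hAc : IsCompact A) (hB : IsConnected B)
    (hBc : IsCompact B) (hAB : A ⊂ B) :
    ∃ C : Set X, IsCompact C ∧ IsConnected C ∧ A ⊂ C ∧ C ⊂ B := by
  obtain ⟨b, hbB, hbA⟩ := exists_of_ssubset hAB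
  obtain ⟨a, ha⟩ := hA.nonempty
  obtain ⟨U, W, hU, hW, hAU, hbW, hUW⟩ :=
    SeparatedNhds.of_isCompact_isCompact hAc isCompact_singleton
      (disjoint_singleton_right.2 hbA)
  have hbU : b ∉ closure U := fun h =>
    (hUW.closure_left hW).le_bot ⟨h, hbW rfl⟩
  have hYc : IsCompact (B ∩ closure U) := hBc.inter_right isClosed_closure
  have hAY : A ⊆ B ∩ closure U := subset_inter hAB.subset (hAU.trans subset_closure)
  -- The witness is this component; it misses `b` because `b ∉ closure U`.
  have hCY : connectedComponentIn (B ∩ closure U) a ⊆ B ∩ closure U :=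
    connectedComponentIn_subset _ _
  have hAC : A ⊆ connectedComponentIn (B ∩ closure U) a :=
    hA.isPreconnected.subset_connectedComponentIn ha hAY
  have : CompactSpace ↥(B ∩ closure U) := isCompact_iff_compactSpace.1 hYc
  have hCc : IsCompact (connectedComponentIn (B ∩ closure U) a) := by
    rw [connectedComponentIn_eq_image (hAY ha)]
    exact isClosed_connectedComponent.isCompact.image continuous_subtype_val
  refine ⟨_, hCc, isConnected_connectedComponentIn_iff.2 (hAY ha),
    ⟨hAC, fun hCA => ?_⟩, fun x hx => (hCY hx).1, fun h => hbU (hCY (h hbB)).2⟩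
  -- If the component were `A`, it would lie in `U`. In a compact Hausdorff space it is an
  -- intersection of clopen sets, so one of them, `Q`, lies in `U`. Then `Q` is clopen in all of
  -- `B`, contains `a` and misses `b`.
  obtain ⟨Q, hQ, haQ, hQU⟩ : ∃ Q : Set ↥(B ∩ closure U), IsClopen Q ∧ ⟨a, hAY ha⟩ ∈ Q ∧
      Q ⊆ Subtype.val ⁻¹' U := by
    have hsub : connectedComponent (⟨a, hAY ha⟩ : ↥(B ∩ closure U)) ⊆ Subtype.val ⁻¹' U := by
      intro z hz
      refine hAU (hCA ?_)
      rw [connectedComponentIn_eq_image (hAY ha)]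
      exact mem_image_of_mem _ hz
    rw [connectedComponent_eq_iInter_isClopen] at hsub
    have hcl : IsCompact (Subtype.val ⁻¹' U : Set ↥(B ∩ closure U))ᶜ :=
      (hU.preimage continuous_subtype_val).isClosed_compl.isCompact
    obtain ⟨t, ht⟩ := hcl.elim_finite_subfamily_closed
      (fun s : { s : Set ↥(B ∩ closure U) // IsClopen s ∧ ⟨a, hAY ha⟩ ∈ s } => s.1)
      (fun s => s.2.1.1) (by
        rw [← disjoint_iff_inter_eq_empty]
        exact disjoint_compl_left_iff_subset.2 hsub)
    refine ⟨⋂ s ∈ t, s.1, isClopen_biInter_finset fun s _ => s.2.1,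
      mem_iInter₂.2 fun s _ => s.2.2, ?_⟩
    rwa [← disjoint_compl_left_iff_subset, disjoint_iff_inter_eq_empty]
  obtain ⟨V, hV, rfl⟩ := isOpen_induced_iff.1 hQ.isOpen
  have hQc : IsClosed ((Subtype.val : ↥(B ∩ closure U) → X) '' (Subtype.val ⁻¹' V)) :=
    (hQ.isClosed.isCompact.image continuous_subtype_val).isClosed
  rw [Subtype.image_preimage_coe] at hQc
  obtain ⟨z, hzB, ⟨hzV, hzU⟩, hz⟩ := hB.isPreconnected (V ∩ U) (B ∩ closure U ∩ V)ᶜ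
    (hV.inter hU) hQc.isOpen_compl
    (by
      intro z hz
      by_cases h : z ∈ B ∩ closure U ∩ V
      · exact Or.inl ⟨h.2, @hQU ⟨z, h.1⟩ h.2⟩
      · exact Or.inr h)
    ⟨a, hAB.subset ha, haQ, hAU ha⟩ ⟨b, hbB, fun h => hbU h.1.2⟩
  exact hz ⟨⟨hzB, subset_closure hzU⟩, hzV⟩

/-! ### Closed conditions and a size function on the hyperspace. -/

namespace TopologicalSpace.NonemptyCompacts

/-- A splitting of `K` into disjoint closed pieces thickens to disjoint open sets; lying in their
union while meeting both is a Vietoris-open condition. -/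
theorem isClosed_setOf_isConnected {X : Type*} [TopologicalSpace X] [T2Space X] :
    IsClosed {K : NonemptyCompacts X | IsConnected (K : Set X)} := by
  rw [← isOpen_compl_iff, isOpen_iff_forall_mem_open]
  intro K hK
  have hK' : ¬ IsPreconnected (K : Set X) := fun h => hK ⟨K.nonempty, h⟩
  rw [isPreconnected_iff_subset_of_fully_disjoint_closed K.isCompact.isClosed] at hK'
  push Not at hK'
  obtain ⟨u, v, hu, hv, hKuv, huv, hKu, hKv⟩ := hK'
  obtain ⟨U, V, hU, hV, huU, hvV, hUV⟩ :=
    SeparatedNhds.of_isCompact_isCompact (K.isCompact.inter_right hu)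
      (K.isCompact.inter_right hv) (huv.mono inter_subset_right inter_subset_right)
  refine ⟨{L | (L : Set X) ⊆ U ∪ V} ∩ ({L | ((L : Set X) ∩ U).Nonempty} ∩
    {L | ((L : Set X) ∩ V).Nonempty}), ?_, ?_, ?_⟩
  · rintro L ⟨hL, hLU, hLV⟩ hc
    obtain ⟨z, -, hzU, hzV⟩ := hc.isPreconnected U V hU hV hL hLU hLV
    exact hUV.le_bot ⟨hzU, hzV⟩
  · exact (isOpen_subsets_of_isOpen (hU.union hV)).inter
      ((isOpen_inter_nonempty_of_isOpen hU).inter (isOpen_inter_nonempty_of_isOpen hV))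
  · refine ⟨fun z hz => (hKuv hz).imp (fun h => huU ⟨hz, h⟩) (fun h => hvV ⟨hz, h⟩), ?_, ?_⟩
    · obtain ⟨z, hz, hzv⟩ := not_subset.1 hKv
      exact ⟨z, hz, huU ⟨hz, (hKuv hz).resolve_right hzv⟩⟩
    · obtain ⟨z, hz, hzu⟩ := not_subset.1 hKu
      exact ⟨z, hz, hvV ⟨hz, (hKuv hz).resolve_left hzu⟩⟩

theorem isClosed_setOf_le {X : Type*} [TopologicalSpace X] [T2Space X] :
    IsClosed {p : NonemptyCompacts X × NonemptyCompacts X | p.1 ≤ p.2} := by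
  simp_rw [← sup_eq_right]
  exact isClosed_eq (continuous_fst.sup continuous_snd) continuous_snd

/-- A continuous strictly monotone size function on the hyperspace (in the reversed order). -/
theorem exists_continuous_strictAnti (X : Type*) [MetricSpace X] [SeparableSpace X] :
    ∃ μ : NonemptyCompacts X → ℝ, Continuous μ ∧ StrictAnti μ := by
  rcases isEmpty_or_nonempty X with hX | hX
  · exact ⟨fun _ => 0, continuous_const, fun A => (hX.false A.nonempty.some).elim⟩
  -- Enlarging `A` lowers every distance, strictly so at a dense point close enough to a new point;
  -- truncation and weights make the sum converge uniformly.
  let c (n : ℕ) (A : NonemptyCompacts X) : ℝ :=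
    (1 / 2) ^ n * min 1 (Metric.infDist (denseSeq X n) A)
  have hc0 (n A) : 0 ≤ c n A := by
    have := Metric.infDist_nonneg (x := denseSeq X n) (s := (A : Set X))
    positivity
  have hc1 (n A) : c n A ≤ (1 / 2) ^ n :=
    mul_le_of_le_one_right (by positivity) (min_le_left _ _)
  have hs (A) : Summable fun n => c n A :=
    Summable.of_nonneg_of_le (fun n => hc0 n A) (fun n => hc1 n A) summable_geometric_two
  refine ⟨fun A => ∑' n, c n A, ?_, fun A B hAB => ?_⟩
  · refine continuous_tsum (fun n => ?_) summable_geometric_two fun n A => ?_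
    · exact continuous_const.mul
        (continuous_const.min (Metric.lipschitz_infDist_set (denseSeq X n)).continuous)
    · rw [Real.norm_of_nonneg (hc0 n A)]
      exact hc1 n A
  · obtain ⟨b, hbB, hbA⟩ := exists_of_ssubset (show (A : Set X) ⊂ B from hAB)
    have hpos : 0 < Metric.infDist b (A : Set X) :=
      (A.isCompact.isClosed.notMem_iff_infDist_pos A.nonempty).1 hbA
    -- Capping at `1` keeps `δ / 2 < 1`, so truncation does not hide the strict decrease.
    set δ := min 1 (Metric.infDist b (A : Set X)) with hδ
    have hδ0 : 0 < δ := lt_min one_pos hpos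
    obtain ⟨n, hn⟩ := (denseRange_denseSeq X).exists_dist_lt b (half_pos hδ0)
    have h1 : Metric.infDist (denseSeq X n) (B : Set X) < δ / 2 :=
      (Metric.infDist_le_dist_of_mem hbB).trans_lt (by rwa [dist_comm])
    have h2 : δ / 2 < Metric.infDist (denseSeq X n) (A : Set X) := by
      have h := Metric.infDist_le_infDist_add_dist (s := (A : Set X)) (x := b) (y := denseSeq X n)
      have := min_le_right 1 (Metric.infDist b (A : Set X))
      linarith
    have h3 : δ ≤ 1 := min_le_left _ _
    refine Summable.tsum_lt_tsum (i := n) (fun m => ?_) ?_ (hs B) (hs A)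
    · exact mul_le_mul_of_nonneg_left (min_le_min_left _
        (Metric.infDist_le_infDist_of_subset hAB.le A.nonempty)) (by positivity)
    · refine mul_lt_mul_of_pos_left ?_ (by positivity)
      exact (min_le_right _ _).trans_lt (h1.trans (lt_min (by linarith) h2))

end TopologicalSpace.NonemptyCompacts

/-! ### Arcs: parametrization, concatenation, and order arcs. -/

theorem Topology.IsEmbedding.isArc_range {Y : Type*} [TopologicalSpace Y] {f : I → Y}
    (hf : IsEmbedding f) : IsArc (range f) :=
  ⟨hf.toHomeomorph.symm⟩

theorem IsArc.exists_isEmbedding {Y : Type*} [TopologicalSpace Y] {A : Set Y} (hA : IsArc A) :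
    ∃ f : I → Y, IsEmbedding f ∧ range f = A := by
  obtain ⟨e⟩ := hA
  refine ⟨Subtype.val ∘ e.symm, IsEmbedding.subtypeVal.comp e.symm.isEmbedding, ?_⟩
  rw [e.symm.surjective.range_comp, Subtype.range_val]

namespace ArcConn

theorem refl {Y : Type*} [TopologicalSpace Y] (x : Y) : ArcConn Y x x := Or.inl rfl

theorem symm {Y : Type*} [TopologicalSpace Y] {x y : Y} (h : ArcConn Y x y) : ArcConn Y y x :=
  h.imp Eq.symm fun ⟨A, hA, hx, hy⟩ => ⟨A, hA, hy, hx⟩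

theorem map {Y Z : Type*} [TopologicalSpace Y] [TopologicalSpace Z] {f : Y → Z}
    (hf : IsEmbedding f) {x y : Y} (h : ArcConn Y x y) : ArcConn Z (f x) (f y) := by
  obtain rfl | ⟨A, hA, hx, hy⟩ := h
  · exact refl _
  · obtain ⟨g, hg, rfl⟩ := hA.exists_isEmbedding
    refine Or.inr ⟨_, (hf.comp hg).isArc_range, ?_, ?_⟩ <;> rw [range_comp]
    exacts [mem_image_of_mem _ hx, mem_image_of_mem _ hy]

theorem of_continuousOn_injOn {Y : Type*} [TopologicalSpace Y] [T2Space Y] {a b : ℝ} {f : ℝ → Y}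
    (hab : a ≤ b) (hf : ContinuousOn f (Icc a b)) (hi : InjOn f (Icc a b)) :
    ArcConn Y (f a) (f b) := by
  obtain rfl | hab := hab.eq_or_lt
  · exact refl _
  have he : IsEmbedding ((Icc a b).domRestrict f ∘ (iccHomeoI a b hab).symm) :=
    ((continuousOn_iff_continuous_domRestrict.1 hf).isClosedEmbedding
      (injOn_iff_injective.1 hi)).isEmbedding.comp (iccHomeoI a b hab).symm.isEmbedding
  refine Or.inr ⟨_, he.isArc_range, ?_, ?_⟩ <;>
    rw [(iccHomeoI a b hab).symm.surjective.range_comp, range_domRestrict]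
  exacts [mem_image_of_mem _ (left_mem_Icc.2 hab.le), mem_image_of_mem _ (right_mem_Icc.2 hab.le)]

theorem exists_continuousOn_injOn {Y : Type*} [TopologicalSpace Y] {x y : Y}
    (h : ArcConn Y x y) : ∃ (a b : ℝ) (f : ℝ → Y), a ≤ b ∧ ContinuousOn f (Icc a b) ∧
      InjOn f (Icc a b) ∧ f a = x ∧ f b = y := by
  obtain rfl | ⟨A, hA, hx, hy⟩ := h
  · exact ⟨0, 0, fun _ => x, le_rfl, continuousOn_const, by simp, rfl, rfl⟩
  obtain ⟨f, hf, rfl⟩ := hA.exists_isEmbedding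
  obtain ⟨s, rfl⟩ := hx
  obtain ⟨t, rfl⟩ := hy
  have hF : ContinuousOn (IccExtend zero_le_one f) (Icc (0 : ℝ) 1) :=
    hf.continuous.Icc_extend'.continuousOn
  have hFi : InjOn (IccExtend zero_le_one f) (Icc (0 : ℝ) 1) :=
    hf.injective.comp_injOn (strictMonoOn_projIcc zero_le_one).injOn
  rcases le_total s t with hst | hst
  · have hsub : Icc (s : ℝ) t ⊆ Icc 0 1 := Icc_subset_Icc s.2.1 t.2.2
    exact ⟨s, t, IccExtend zero_le_one f, hst, hF.mono hsub, hFi.mono hsub,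
      IccExtend_val _ _ _, IccExtend_val _ _ _⟩
  · have hmap : MapsTo (fun r : ℝ => -r) (Icc (-(s : ℝ)) (-t)) (Icc 0 1) := fun r hr =>
      ⟨by have := t.2.1; linarith [hr.2], by have := s.2.2; linarith [hr.1]⟩
    refine ⟨-s, -t, fun r => IccExtend zero_le_one f (-r), neg_le_neg hst,
      hF.comp continuous_neg.continuousOn hmap, hFi.comp neg_injective.injOn hmap, ?_, ?_⟩
    · simp [IccExtend_val]
    · simp [IccExtend_val]

theorem trans {Y : Type*} [TopologicalSpace Y] [T2Space Y] {x y z : Y}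
    (hxy : ArcConn Y x y) (hyz : ArcConn Y y z) : ArcConn Y x z := by
  obtain ⟨a, b, f, hab, hf, hfi, rfl, rfl⟩ := hxy.exists_continuousOn_injOn
  obtain ⟨c, d, g, hcd, hg, hgi, hgc, rfl⟩ := hyz.exists_continuousOn_injOn
  -- Switch from `f` to `g` at the first time `t` at which `f` hits the second arc: before `t` the
  -- two do not meet, so the concatenation is injective.
  have hK : IsCompact (Icc a b ∩ f ⁻¹' (g '' Icc c d)) :=
    isCompact_Icc.of_isClosed_subset
      (hf.preimage_isClosed_of_isClosed isClosed_Icc (isCompact_Icc.image_of_continuousOn hg).isClosed)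
      inter_subset_left
  obtain ⟨t, ⟨ht, s, hs, hst⟩, hmin⟩ := hK.exists_isLeast
    ⟨b, right_mem_Icc.2 hab, c, left_mem_Icc.2 hcd, hgc⟩
  have hlt {r : ℝ} (hr : r ∈ Icc a b) (hrt : r < t) {q : ℝ} (hq : q ∈ Icc c d) : g q ≠ f r :=
    fun h => hrt.not_ge (hmin ⟨hr, q, hq, h⟩)
  have hat : Icc a t ⊆ Icc a b := Icc_subset_Icc_right ht.2
  have hshift : MapsTo (fun r => r - t + s) (Icc t (t + (d - s))) (Icc c d) := fun r hr =>
    ⟨by linarith [hr.1, hs.1], by linarith [hr.2]⟩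
  have hle : t ≤ t + (d - s) := by linarith [hs.2]
  let h : ℝ → Y := fun r => if r ≤ t then f r else g (r - t + s)
  have hL : EqOn h f (Icc a t) := fun r hr => if_pos hr.2
  have hR : EqOn h (fun r => g (r - t + s)) (Icc t (t + (d - s))) := fun r hr => by
    obtain rfl | hr' := hr.1.eq_or_lt
    · simp [h, hst]
    · exact if_neg hr'.not_ge
  have hun : Icc a (t + (d - s)) = Icc a t ∪ Icc t (t + (d - s)) :=
    (Icc_union_Icc_eq_Icc ht.1 hle).symm
  have hcont : ContinuousOn h (Icc a (t + (d - s))) := by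
    rw [hun]
    refine ContinuousOn.union_of_isClosed ?_ ?_ isClosed_Icc isClosed_Icc
    · exact (hf.mono hat).congr hL
    · exact (hg.comp (by fun_prop) hshift).congr hR
  have hinj : InjOn h (Icc a (t + (d - s))) := by
    have key {p q : ℝ} (hp : p ∈ Icc a (t + (d - s))) (hq : q ∈ Icc a (t + (d - s)))
        (hpq : p ≤ q) (he : h p = h q) : p = q := by
      rcases le_or_gt q t with hqt | hqt
      · have hp' : p ∈ Icc a t := ⟨hp.1, hpq.trans hqt⟩
        have hq' : q ∈ Icc a t := ⟨hq.1, hqt⟩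
        rw [hL hp', hL hq'] at he
        exact hfi (hat hp') (hat hq') he
      · have hq' : q ∈ Icc t (t + (d - s)) := ⟨hqt.le, hq.2⟩
        rcases lt_or_ge p t with hpt | hpt
        · have hp' : p ∈ Icc a t := ⟨hp.1, hpt.le⟩
          rw [hL hp', hR hq'] at he
          exact (hlt (hat hp') hpt (hshift hq') he.symm).elim
        · have hp' : p ∈ Icc t (t + (d - s)) := ⟨hpt, hp.2⟩
          rw [hR hp', hR hq'] at he
          have := hgi (hshift hp') (hshift hq') he
          simp only at this
          linarith
    intro p hp q hq he
    rcases le_total p q with hpq | hpq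
    · exact key hp hq hpq he
    · exact (key hq hp hpq he.symm).symm
  have := of_continuousOn_injOn (ht.1.trans hle) hcont hinj
  rw [hL (left_mem_Icc.2 ht.1), hR (right_mem_Icc.2 hle)] at this
  simpa using this

/-- Maximal chains in a densely ordered compact pospace are arcs, provided that there is a
continuous strictly monotone function. -/
theorem bot_top {T : Type*} [TopologicalSpace T] [CompactSpace T] [PartialOrder T]
    [BoundedOrder T] [DenselyOrdered T] [OrderClosedTopology T] {μ : T → ℝ} (hμ : Continuous μ)
    (hanti : StrictAnti μ) : ArcConn T ⊥ ⊤ := by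
  rcases eq_or_ne (⊥ : T) ⊤ with h | hne
  · exact Or.inl h
  have hμne : μ ⊤ < μ ⊥ := hanti (bot_lt_iff_ne_bot.2 hne.symm)
  let M : Set T := maxChain (· ≤ ·)
  have hM : IsMaxChain (· ≤ ·) M := maxChain_spec
  have htot {p q : T} (hp : p ∈ M) (hq : q ∈ M) : p ≤ q ∨ q ≤ p := hM.isChain.total hp hq
  have hle {p q : T} (hp : p ∈ M) (hq : q ∈ M) (h : μ q ≤ μ p) : p ≤ q :=
    (htot hp hq).elim id fun hqp => (hqp.eq_or_lt.elim Eq.ge fun hlt => (h.not_gt (hanti hlt)).elim)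
  -- The closure of a chain is a chain, so maximality makes `M` closed.
  have hcl : IsClosed M := by
    have htot' : ∀ z ∈ closure M ×ˢ closure M, z.1 ≤ z.2 ∨ z.2 ≤ z.1 := by
      have hC : IsClosed {z : T × T | z.1 ≤ z.2 ∨ z.2 ≤ z.1} :=
        (isClosed_le continuous_fst continuous_snd).union
          (isClosed_le continuous_snd continuous_fst)
      rw [← closure_prod_eq]
      exact fun z hz => closure_minimal (fun z hz => htot hz.1 hz.2) hC hz
    have : M = closure M := hM.2 (fun p hp q hq _ => htot' (p, q) ⟨hp, hq⟩) subset_closure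
    rw [this]
    exact isClosed_closure
  have hMc : CompactSpace M := isCompact_iff_compactSpace.1 hcl.isCompact
  have himc : IsCompact (μ '' M) := hcl.isCompact.image hμ
  -- A missed value `t` would leave a gap `p < q` in `M`; an element strictly between is comparable
  -- with all of `M`, hence belongs to it, a contradiction.
  have hsurj : Icc (μ ⊤) (μ ⊥) ⊆ μ '' M := by
    intro t ht
    by_contra htM
    obtain ⟨_, ⟨⟨p, hp, rfl⟩, htp⟩, hpmin⟩ := (himc.inter_right (isClosed_Ici (a := t))).exists_isLeast
      ⟨μ ⊥, mem_image_of_mem _ hM.bot_mem, ht.2⟩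
    obtain ⟨_, ⟨⟨q, hq, rfl⟩, hqt⟩, hqmax⟩ :=
      (himc.inter_right (isClosed_Iic (a := t))).exists_isGreatest
        ⟨μ ⊤, mem_image_of_mem _ hM.top_mem, ht.1⟩
    have hqt' : μ q < t := lt_of_le_of_ne hqt fun h => htM ⟨q, hq, h⟩
    have hpq : p < q := lt_of_le_of_ne (hle hp hq (hqt.trans htp)) fun h =>
      (hqt'.trans_le htp).ne (h ▸ rfl)
    obtain ⟨c, hpc, hcq⟩ := exists_between hpq
    have hcM : c ∈ M := by
      rw [hM.2 (hM.isChain.insert (a := c) fun D hD _ => ?_) (subset_insert _ _)]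
      · exact mem_insert _ _
      rcases le_total t (μ D) with h | h
      · exact Or.inr ((hle hD hp (hpmin ⟨mem_image_of_mem _ hD, h⟩)).trans hpc.le)
      · exact Or.inl (hcq.le.trans (hle hq hD (hqmax ⟨mem_image_of_mem _ hD, h⟩)))
    rcases le_total t (μ c) with h | h
    · exact (hpmin ⟨mem_image_of_mem _ hcM, h⟩).not_gt (hanti hpc)
    · exact (hqmax ⟨mem_image_of_mem _ hcM, h⟩).not_gt (hanti hcq)
  let φ : M → Icc (μ ⊤) (μ ⊥) := fun p => ⟨μ p, hanti.antitone le_top, hanti.antitone bot_le⟩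
  have hφc : Continuous φ := (hμ.comp continuous_subtype_val).subtype_mk _
  have hφ : Function.Bijective φ := by
    refine ⟨fun p q h => ?_, fun t => ?_⟩
    · have h' : μ p = μ q := congrArg Subtype.val h
      exact Subtype.ext (le_antisymm (hle p.2 q.2 h'.ge) (hle q.2 p.2 h'.le))
    · obtain ⟨p, hp, hpt⟩ := hsurj t.2
      exact ⟨⟨p, hp⟩, Subtype.ext hpt⟩
  have e : M ≃ₜ Icc (μ ⊤) (μ ⊥) :=
    Continuous.homeoOfEquivCompactToT2 (f := Equiv.ofBijective φ hφ) hφc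
  exact Or.inr ⟨M, ⟨e.trans (iccHomeoI _ _ hμne)⟩, hM.bot_mem, hM.top_mem⟩

end ArcConn

/-! ### Chains of small continua versus arcs in the hyperspace. -/

theorem singleton_mem_smallContinua {X : Type*} [MetricSpace X] {ε : ℝ} (hε : 0 < ε) (x : X) :
    {x} ∈ smallContinua X ε := by
  simpa [smallContinua, isConnected_singleton] using hε

/-- A continuum is joined to each of its points by an arc of continua lying between them. -/
theorem arcConn_singleton {X : Type*} [MetricSpace X] [SeparableSpace X] {ε : ℝ} (hε : 0 < ε)
    {K : NonemptyCompacts X} (hK : K ∈ smallContinua X ε) {x : X} (hx : x ∈ K) :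
    ArcConn (smallContinua X ε) ⟨{x}, singleton_mem_smallContinua hε x⟩ ⟨K, hK⟩ := by
  let S : Set (NonemptyCompacts X) := {L | IsConnected (L : Set X) ∧ {x} ≤ L ∧ L ≤ K}
  have hxK : {x} ≤ K := singleton_subset_iff.2 hx
  have hScl : IsClosed S :=
    NonemptyCompacts.isClosed_setOf_isConnected.and
      ((NonemptyCompacts.isClosed_setOf_le.preimage (.prodMk_right ({x} : NonemptyCompacts X))).and
        (NonemptyCompacts.isClosed_setOf_le.preimage (.prodMk_left K)))
  have hSc : IsCompact S := (NonemptyCompacts.isCompact_subsets_of_isCompact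
    K.isCompact).of_isClosed_subset hScl fun L hL => hL.2.2
  have : CompactSpace S := isCompact_iff_compactSpace.1 hSc
  have : OrderClosedTopology S :=
    ⟨NonemptyCompacts.isClosed_setOf_le.preimage
      (continuous_subtype_val.prodMap continuous_subtype_val)⟩
  let _ : BoundedOrder S :=
    { bot := ⟨{x}, by simp [isConnected_singleton], le_rfl, hxK⟩
      bot_le := fun L => L.2.2.1
      top := ⟨K, hK.1, hxK, le_rfl⟩
      le_top := fun L => L.2.2.2 }
  have : DenselyOrdered S := by
    refine ⟨fun A B hAB => ?_⟩
    obtain ⟨C, hCc, hC, hAC, hCB⟩ := A.2.1.exists_isCompact_between A.1.isCompact B.2.1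
      B.1.isCompact (show (A.1 : Set X) ⊂ B.1 from hAB)
    exact ⟨⟨⟨⟨C, hCc⟩, hC.nonempty⟩, hC, A.2.2.1.trans hAC.le, hCB.le.trans B.2.2.2⟩, hAC, hCB⟩
  obtain ⟨μ, hμ, hanti⟩ := NonemptyCompacts.exists_continuous_strictAnti X
  have hSsub (L : S) : L.1 ∈ smallContinua X ε :=
    ⟨L.2.1, (Metric.diam_mono L.2.2.2 K.isCompact.isBounded).trans_lt hK.2⟩
  exact (ArcConn.bot_top (T := S) (hμ.comp continuous_subtype_val)
    fun A B hAB => hanti hAB).map (IsEmbedding.subtypeVal.codRestrict (smallContinua X ε) hSsub)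

/-- Two points lie in a common continuum of diameter less than `ε`. -/
def SmallContinuumAdj (X : Type*) [MetricSpace X] (ε : ℝ) (x y : X) : Prop :=
  ∃ K ∈ smallContinua X ε, x ∈ K ∧ y ∈ K

theorem SmallContinuumAdj.symm {X : Type*} [MetricSpace X] {ε : ℝ} {x y : X}
    (h : SmallContinuumAdj X ε x y) : SmallContinuumAdj X ε y x :=
  let ⟨K, hK, hx, hy⟩ := h
  ⟨K, hK, hy, hx⟩

/-- A chain with `k = 0` still uses one continuum, hence `TransGen` and not its reflexive version.
-/
theorem epsChainConn_iff_transGen {X : Type*} [MetricSpace X] {ε : ℝ} {x y : X} :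
    EpsChainConn X ε x y ↔ Relation.TransGen (SmallContinuumAdj X ε) x y := by
  constructor
  · rintro ⟨k, K, hK, hx, hy, hKK⟩
    induction k generalizing x with
    | zero => exact .single ⟨K 0, hK 0, hx, hy⟩
    | succ k ih =>
      obtain ⟨z, hz0, hz1⟩ := hKK 0
      exact .head ⟨K 0, hK 0, hx, hz0⟩
        (ih (fun i => K i.succ) (fun i => hK i.succ) hz1 hy fun i => hKK i.succ)
  · intro h
    induction h using Relation.TransGen.head_induction_on with
    | single h =>
      obtain ⟨K, hK, hx, hy⟩ := h
      exact ⟨0, fun _ => K, fun _ => hK, hx, hy, fun i => i.elim0⟩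
    | head h _ ih =>
      obtain ⟨K, hK, hx, hz⟩ := h
      obtain ⟨k, L, hL, hzL, hy, hLL⟩ := ih
      refine ⟨k + 1, Fin.cons K L, Fin.cases hK hL, hx, ?_, Fin.cases ⟨_, hz, hzL⟩ hLL⟩
      rw [← Fin.succ_last, Fin.cons_succ]
      exact hy

theorem EpsChainConn.arcConn {X : Type*} [MetricSpace X] [SeparableSpace X] {ε : ℝ}
    (hε : 0 < ε) {x y : X} (h : EpsChainConn X ε x y) :
    ArcConn (smallContinua X ε) ⟨{x}, singleton_mem_smallContinua hε x⟩
      ⟨{y}, singleton_mem_smallContinua hε y⟩ := by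
  have hadj {x y : X} (h : SmallContinuumAdj X ε x y) :
      ArcConn (smallContinua X ε) ⟨{x}, singleton_mem_smallContinua hε x⟩
        ⟨{y}, singleton_mem_smallContinua hε y⟩ :=
    let ⟨_, hK, hx, hy⟩ := h
    (arcConn_singleton hε hK hx).trans (arcConn_singleton hε hK hy).symm
  rw [epsChainConn_iff_transGen] at h
  induction h with
  | single h => exact hadj h
  | tail _ h ih => exact ih.trans (hadj h)

/-- Along a path of small continua, the points of nearby continua lie in a common one. -/
theorem eventually_smallContinuumAdj {X : Type*} [MetricSpace X] {ε : ℝ}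
    {F : ℝ → smallContinua X ε} (hF : Continuous F) (s : ℝ) :
    ∀ᶠ t in 𝓝 s, ∀ x ∈ (F s).1, ∀ y ∈ (F t).1, SmallContinuumAdj X ε x y := by
  have hF' : Continuous fun t => (F t).1 := continuous_subtype_val.comp hF
  -- Thickening by `δ` adds at most `2 * δ` to the diameter, half of the available slack.
  obtain ⟨δ, hδ, hδε⟩ : ∃ δ : ℝ, 0 < δ ∧ Metric.diam ((F s).1 : Set X) + 2 * δ < ε :=
    ⟨(ε - Metric.diam ((F s).1 : Set X)) / 4, by linarith [(F s).2.2], by linarith [(F s).2.2]⟩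
  have hopen : IsOpen {t | ((F t).1 : Set X) ⊆ Metric.thickening δ ((F s).1 : Set X)} :=
    (NonemptyCompacts.isOpen_subsets_of_isOpen Metric.isOpen_thickening).preimage hF'
  obtain ⟨η, hη, hball⟩ := Metric.isOpen_iff.1 hopen s (Metric.self_subset_thickening hδ _)
  filter_upwards [Metric.ball_mem_nhds s hη] with t ht x hx y hy
  have hseg : uIcc s t ⊆ Metric.ball s η := by
    rw [← segment_eq_uIcc]
    exact (convex_ball s η).segment_subset (Metric.mem_ball_self hη) ht
  have hcomp : IsCompact (⋃ r ∈ uIcc s t, ((F r).1 : Set X)) := by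
    have := NonemptyCompacts.isCompact_biUnion_coe_of_isCompact
      (isCompact_uIcc.image (s := uIcc s t) hF')
    rwa [biUnion_image] at this
  -- For a Vietoris-continuous family over a connected set, one connected member makes the union
  -- connected.
  have hconn : IsPreconnected (⋃ r ∈ uIcc s t, ((F r).1 : Set X)) := by
    let _ := TopologicalSpace.vietoris X
    exact vietoris.isPreconnected_biUnion isPreconnected_uIcc
      (NonemptyCompacts.continuous_coe.comp hF').continuousOn
      ⟨s, left_mem_uIcc, (F s).2.1.isPreconnected⟩
  have hx' : x ∈ ⋃ r ∈ uIcc s t, ((F r).1 : Set X) := mem_biUnion left_mem_uIcc hx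
  have hy' : y ∈ ⋃ r ∈ uIcc s t, ((F r).1 : Set X) := mem_biUnion right_mem_uIcc hy
  have hsub : (⋃ r ∈ uIcc s t, ((F r).1 : Set X)) ⊆ Metric.thickening δ ((F s).1 : Set X) :=
    iUnion₂_subset fun r hr => hball (hseg hr)
  refine ⟨⟨⟨_, hcomp⟩, ⟨x, hx'⟩⟩, ⟨⟨⟨x, hx'⟩, hconn⟩, ?_⟩, hx', hy'⟩
  exact (Metric.diam_mono hsub (F s).1.isCompact.isBounded.thickening).trans_lt
    ((Metric.diam_thickening_le _ hδ.le).trans_lt hδε)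

theorem ArcConn.epsChainConn {X : Type*} [MetricSpace X] {ε : ℝ} {K L : smallContinua X ε}
    (h : ArcConn (smallContinua X ε) K L) {x y : X} (hx : x ∈ K.1) (hy : y ∈ L.1) :
    EpsChainConn X ε x y := by
  rw [epsChainConn_iff_transGen]
  obtain rfl | ⟨A, hA, hKA, hLA⟩ := h
  · exact .single ⟨K, K.2, hx, hy⟩
  obtain ⟨f, hf, rfl⟩ := hA.exists_isEmbedding
  obtain ⟨s, rfl⟩ := hKA
  obtain ⟨t, rfl⟩ := hLA
  have hF : Continuous (IccExtend zero_le_one f) := hf.continuous.Icc_extend'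
  -- Connectedness of `ℝ` turns the local, two-sided statement into a global one by transitivity.
  have key := PreconnectedSpace.induction₂' (α := ℝ)
    (fun p q => ∀ x ∈ (IccExtend zero_le_one f p).1, ∀ y ∈ (IccExtend zero_le_one f q).1,
      Relation.TransGen (SmallContinuumAdj X ε) x y)
    (fun p => by
      filter_upwards [eventually_smallContinuumAdj hF p] with q hq
      exact ⟨fun x hx y hy => .single (hq x hx y hy),
        fun y hy x hx => .single (hq x hx y hy).symm⟩)
    ⟨fun p q r hpq hqr x hx z hz =>
      let ⟨y, hy⟩ := (IccExtend zero_le_one f q).1.nonempty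
      (hpq x hx y hy).trans (hqr y hy z hz)⟩ s t
  rw [IccExtend_val, IccExtend_val] at key
  exact key x hx y hy

theorem arcConn_iff_epsChainConn {X : Type*} [MetricSpace X] [SeparableSpace X] {ε : ℝ}
    (hε : 0 < ε) {K L : smallContinua X ε} {x y : X} (hx : x ∈ K.1) (hy : y ∈ L.1) :
    ArcConn (smallContinua X ε) K L ↔ EpsChainConn X ε x y :=
  ⟨fun h => h.epsChainConn hx hy, fun h =>
    (arcConn_singleton hε K.2 hx).symm.trans ((h.arcConn hε).trans (arcConn_singleton hε L.2 hy))⟩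

theorem EpsChainConn.mono {X : Type*} [MetricSpace X] {ε δ : ℝ} (hεδ : ε ≤ δ) {x y : X}
    (h : EpsChainConn X ε x y) : EpsChainConn X δ x y :=
  let ⟨k, K, hK, hxy⟩ := h
  ⟨k, K, fun i => ⟨(hK i).1, (hK i).2.trans_le hεδ⟩, hxy⟩

theorem chainConn_iff_forall_nat {X : Type*} [MetricSpace X] {x y : X} :
    ChainConn X x y ↔ ∀ n : ℕ, EpsChainConn X (1 / ((n : ℝ) + 1)) x y := by
  refine ⟨fun h n => h _ Nat.one_div_pos_of_nat, fun h ε hε => ?_⟩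
  obtain ⟨n, hn⟩ := exists_nat_one_div_lt hε
  exact (h n).mono hn.le

theorem interArcConn_iff_chainConn {X : Type*} [MetricSpace X] [SeparableSpace X]
    {K L : ↥(⋂ n : ℕ, smallContinua X (1 / ((n : ℝ) + 1)))} {x y : X}
    (hx : x ∈ K.1) (hy : y ∈ L.1) : InterArcConn X K L ↔ ChainConn X x y := by
  rw [chainConn_iff_forall_nat]
  exact forall_congr' fun n => arcConn_iff_epsChainConn Nat.one_div_pos_of_nat hx hy

/-! ### A Borel selector for compact sets. -/

/-- Indices in a sequence `u` of approximations to a point of `K`: the ball of radius `2⁻ⁿ` around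
the `n`-th one meets `K` inside the previous ball. -/
noncomputable def selectorIndex {X : Type*} [MetricSpace X] (u : ℕ → X)
    (K : NonemptyCompacts X) : ℕ → ℕ
  | 0 => sInf {i | ((K : Set X) ∩ Metric.ball (u i) 1).Nonempty}
  | n + 1 => sInf {i | ((K : Set X) ∩ (Metric.ball (u (selectorIndex u K n)) ((1 / 2) ^ n) ∩
      Metric.ball (u i) ((1 / 2) ^ (n + 1)))).Nonempty}

theorem exists_inter_ball_nonempty {X : Type*} [MetricSpace X] {u : ℕ → X} (hu : DenseRange u)
    {s : Set X} (hs : s.Nonempty) {r : ℝ} (hr : 0 < r) :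
    ∃ i, (s ∩ Metric.ball (u i) r).Nonempty :=
  let ⟨z, hz⟩ := hs
  let ⟨i, hi⟩ := hu.exists_dist_lt z hr
  ⟨i, z, hz, hi⟩

/-- Density makes each index set nonempty, so `sInf` is attained and never the default `0`. -/
theorem selectorIndex_inter_nonempty {X : Type*} [MetricSpace X] {u : ℕ → X} (hu : DenseRange u)
    (K : NonemptyCompacts X) (n : ℕ) :
    ((K : Set X) ∩ Metric.ball (u (selectorIndex u K n)) ((1 / 2) ^ n)).Nonempty ∧
    ((K : Set X) ∩ (Metric.ball (u (selectorIndex u K n)) ((1 / 2) ^ n) ∩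
      Metric.ball (u (selectorIndex u K (n + 1))) ((1 / 2) ^ (n + 1)))).Nonempty := by
  have hstep (n : ℕ)
      (h : ((K : Set X) ∩ Metric.ball (u (selectorIndex u K n)) ((1 / 2) ^ n)).Nonempty) :
      ((K : Set X) ∩ (Metric.ball (u (selectorIndex u K n)) ((1 / 2) ^ n) ∩
        Metric.ball (u (selectorIndex u K (n + 1))) ((1 / 2) ^ (n + 1)))).Nonempty := by
    refine Nat.sInf_mem (s := {i | ((K : Set X) ∩ (Metric.ball (u (selectorIndex u K n))
      ((1 / 2) ^ n) ∩ Metric.ball (u i) ((1 / 2) ^ (n + 1)))).Nonempty}) ?_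
    obtain ⟨i, hi⟩ := exists_inter_ball_nonempty hu h (r := (1 / 2) ^ (n + 1)) (by positivity)
    exact ⟨i, by rwa [inter_assoc] at hi⟩
  have hfst : ((K : Set X) ∩ Metric.ball (u (selectorIndex u K n)) ((1 / 2) ^ n)).Nonempty := by
    induction n with
    | zero =>
      rw [pow_zero]
      exact Nat.sInf_mem (s := {i | ((K : Set X) ∩ Metric.ball (u i) 1).Nonempty})
        (exists_inter_ball_nonempty hu K.nonempty one_pos)
    | succ n ih => exact (hstep n ih).mono fun z hz => ⟨hz.1, hz.2.2⟩
  exact ⟨hfst, hstep n hfst⟩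

theorem measurable_nat_sInf {α : Type*} [MeasurableSpace α] {p : α → ℕ → Prop}
    (hp : ∀ a, ∃ n, p a n) (hm : ∀ n, MeasurableSet {a | p a n}) :
    Measurable fun a => sInf {n | p a n} := by
  classical
  have : (fun a => sInf {n | p a n}) = fun a => Nat.find (hp a) :=
    funext fun a => Nat.sInf_def (hp a)
  rw [this]
  exact measurable_find hp hm

theorem measurable_selectorIndex {X : Type*} [MetricSpace X] {u : ℕ → X} (hu : DenseRange u)
    (n : ℕ) : Measurable fun K : NonemptyCompacts X => selectorIndex u K n := by
  induction n with
  | zero =>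
    exact measurable_nat_sInf (fun K => exists_inter_ball_nonempty hu K.nonempty one_pos) fun i =>
      (NonemptyCompacts.isOpen_inter_nonempty_of_isOpen Metric.isOpen_ball).measurableSet
  | succ n ih =>
    refine measurable_nat_sInf (p := fun (K : NonemptyCompacts X) i => ((K : Set X) ∩
      (Metric.ball (u (selectorIndex u K n)) ((1 / 2) ^ n) ∩
        Metric.ball (u i) ((1 / 2) ^ (n + 1)))).Nonempty)
      (fun K => ⟨_, (selectorIndex_inter_nonempty hu K n).2⟩) fun i => ?_
    -- Splitting over the countably many values of the previous index leaves an open condition with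
    -- fixed balls.
    have : {K : NonemptyCompacts X | ((K : Set X) ∩
        (Metric.ball (u (selectorIndex u K n)) ((1 / 2) ^ n) ∩
          Metric.ball (u i) ((1 / 2) ^ (n + 1)))).Nonempty} =
        ⋃ j, {K | selectorIndex u K n = j} ∩ {K | ((K : Set X) ∩
          (Metric.ball (u j) ((1 / 2) ^ n) ∩
            Metric.ball (u i) ((1 / 2) ^ (n + 1)))).Nonempty} := by
      ext K
      simp
    rw [this]
    exact .iUnion fun j => (ih (measurableSet_singleton j)).inter
      (NonemptyCompacts.isOpen_inter_nonempty_of_isOpen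
        (Metric.isOpen_ball.inter Metric.isOpen_ball)).measurableSet

/-- There is a Borel choice function on the hyperspace of nonempty compact sets. -/
theorem exists_measurable_selector (X : Type*) [MetricSpace X] [SeparableSpace X]
    [MeasurableSpace X] [BorelSpace X] :
    ∃ g : NonemptyCompacts X → X, Measurable g ∧ ∀ K, g K ∈ K := by
  rcases isEmpty_or_nonempty X with hX | hX
  · exact ⟨fun K => K.nonempty.some, measurable_of_subsingleton_codomain _, fun K =>
      K.nonempty.some_mem⟩
  have hu := denseRange_denseSeq X
  have hlim (K : NonemptyCompacts X) : ∃ z ∈ K,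
      Tendsto (fun n => denseSeq X (selectorIndex (denseSeq X) K n)) atTop (𝓝 z) := by
    choose y hyK hy using fun n => (selectorIndex_inter_nonempty hu K n).1
    have hd (n : ℕ) : dist (denseSeq X (selectorIndex (denseSeq X) K n))
        (denseSeq X (selectorIndex (denseSeq X) K (n + 1))) ≤ 2 * (1 / 2) ^ n := by
      obtain ⟨z, -, hz, hz'⟩ := (selectorIndex_inter_nonempty hu K n).2
      have h1 : (1 / 2 : ℝ) ^ (n + 1) ≤ (1 / 2) ^ n :=
        pow_le_pow_of_le_one (by norm_num) (by norm_num) n.le_succ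
      have h2 := dist_triangle_left (denseSeq X (selectorIndex (denseSeq X) K n))
        (denseSeq X (selectorIndex (denseSeq X) K (n + 1))) z
      rw [Metric.mem_ball] at hz hz'
      linarith
    have hc : CauchySeq fun n => denseSeq X (selectorIndex (denseSeq X) K n) :=
      cauchySeq_of_le_geometric (1 / 2) 2 (by norm_num) hd
    have hyd : Tendsto (fun n => dist (y n) (denseSeq X (selectorIndex (denseSeq X) K n)))
        atTop (𝓝 0) :=
      squeeze_zero (fun _ => dist_nonneg) (fun n => (Metric.mem_ball.1 (hy n)).le)
        (tendsto_pow_atTop_nhds_zero_of_lt_one (by norm_num) (by norm_num))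
    -- The limit comes from compactness of `K`, not completeness of the metric: nearby points `y n ∈
    -- K` subconverge, and the Cauchy property does the rest.
    obtain ⟨z, hz, φ, hφ, hφz⟩ := K.isCompact.tendsto_subseq hyK
    refine ⟨z, hz, tendsto_nhds_of_cauchySeq_of_subseq hc hφ.tendsto_atTop ?_⟩
    exact (tendsto_iff_of_dist (hyd.comp hφ.tendsto_atTop)).1 hφz
  choose g hgK hg using hlim
  refine ⟨g, measurable_of_tendsto_metrizable (fun n => ?_) (tendsto_pi_nhds.2 hg), hgK⟩
  exact (measurable_from_nat (f := denseSeq X)).comp (measurable_selectorIndex hu n)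

theorem mainTheorem5 (X : Type*) [MetricSpace X] [PolishSpace X]
    [MeasurableSpace X] [BorelSpace X] :
    (∀ ε : ℝ, 0 < ε →
      BorelBireducible (EpsChainConn X ε) (ArcConn (smallContinua X ε))) ∧
    BorelBireducible (ChainConn X) (InterArcConn X) := by
  obtain ⟨g, hg, hgK⟩ := exists_measurable_selector X
  have hsing : Measurable fun x : X => ({x} : NonemptyCompacts X) :=
    NonemptyCompacts.continuous_singleton.measurable
  have hmem (x : X) : x ∈ ({x} : NonemptyCompacts X) := rfl
  refine ⟨fun ε hε => ⟨?_, ?_⟩, ?_, ?_⟩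
  · exact ⟨fun x => ⟨{x}, singleton_mem_smallContinua hε x⟩, hsing.subtype_mk, fun x y =>
      (arcConn_iff_epsChainConn hε (hmem x) (hmem y)).symm⟩
  · exact ⟨fun K => g K.1, hg.comp measurable_subtype_coe, fun K L =>
      arcConn_iff_epsChainConn hε (hgK _) (hgK _)⟩
  · exact ⟨fun x => ⟨{x}, mem_iInter.2 fun _ =>
      singleton_mem_smallContinua Nat.one_div_pos_of_nat x⟩, hsing.subtype_mk, fun x y =>
      (interArcConn_iff_chainConn (hmem x) (hmem y)).symm⟩
  · exact ⟨fun K => g K.1, hg.comp measurable_subtype_coe, fun K L =>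
      interArcConn_iff_chainConn (hgK _) (hgK _)⟩
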